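/- Let $M \subset \mathbb{R}^3$ be a closed (that is, compact and without boundary), orientable embedded $C^2$ surface, not necessarily connected. Let its medial axis $\mathcal{A}_M$ be the set of points $q \in \mathbb{R}^3$ for which there are two distinct points $\hat p, \tilde p \in M$ with $|q-\hat p| = |q-\tilde p| = \min_{m \in M} |q-m|$, and suppose that its reach $$\rho = \inf\{\, |a-m| : a \in \mathcal{A}_M,\ m \in M \,\}$$ is a positive (finite) real number. Let $p \in M$, let $N_p$ be a unit normal vector of $M$ at $p$, and let $r < \rho$. Then the image of $B_r(p) \cap M$ under the projection in direction of $N_p$ to the affine tangent plane $p + T_pM$ is a convex set, where $B_r(p)$ may be taken to be the closed or the open Euclidean ball of radius $r$ centred at $p$. -/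

import Mathlib

/-- Euclidean three-space. -/
abbrev E3 : Type := EuclideanSpace ℝ (Fin 3)

/-- The parameter plane. -/
abbrev E2 : Type := EuclideanSpace ℝ (Fin 2)

/-- `M` is an embedded `C^2` surface without boundary in Euclidean three-space: every point of `M`
has an open neighbourhood `V` such that `M ∩ V` is the image of an open set `U` of the plane under
a `C^2` map that is a homeomorphism of `U` onto `M ∩ V` and has injective differential on `U`. -/
def IsC2Surface (M : Set E3) : Prop :=
  ∀ p ∈ M, ∃ V : Set E3, IsOpen V ∧ p ∈ V ∧
    ∃ (U : Set E2) (X : E2 → E3), IsOpen U ∧ ContDiffOn ℝ 2 X U ∧ X '' U = M ∩ V ∧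
      Topology.IsEmbedding (fun u : U => X u) ∧
      ∀ u ∈ U, Function.Injective (fderiv ℝ X u)

/-- The tangent space at `p` (a linear subspace): it is spanned by the velocities at time `0` of
curves lying in `M` that pass through `p` at time `0`. -/
noncomputable def tangentSpaceAt (M : Set E3) (p : E3) : Submodule ℝ E3 :=
  Submodule.span ℝ {v : E3 | ∃ γ : ℝ → E3,
    γ 0 = p ∧ (∀ᶠ t in nhds (0 : ℝ), γ t ∈ M) ∧ HasDerivAt γ v 0}

/-- The affine tangent plane `p + T_p M`. -/
noncomputable def tangentPlane (M : Set E3) (p : E3) : AffineSubspace ℝ E3 :=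
  AffineSubspace.mk' p (tangentSpaceAt M p)

/-- `N` is a unit normal vector of `M` at `p`. -/
def IsUnitNormalAt (M : Set E3) (p N : E3) : Prop :=
  ‖N‖ = 1 ∧ N ∈ (tangentSpaceAt M p)ᗮ

/-- `M` is orientable: it has a continuous field of unit normal vectors. -/
def IsOrientableSurface (M : Set E3) : Prop :=
  ∃ ν : E3 → E3, ContinuousOn ν M ∧ ∀ q ∈ M, IsUnitNormalAt M q (ν q)

/-- The medial axis of `M`: the points whose distance to `M` is attained at two or more distinct
points of `M`. -/
def medialAxis (M : Set E3) : Set E3 :=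
  {q | ∃ a ∈ M, ∃ b ∈ M, a ≠ b ∧ dist q a = Metric.infDist q M ∧ dist q b = Metric.infDist q M}

/-- The real number `ρ` is the reach of `M`, that is, the infimum of the distances between points of
the medial axis and points of `M`. (No real number satisfies this if there are no such pairs.) -/
def IsReach (M : Set E3) (ρ : ℝ) : Prop :=
  IsGLB {d : ℝ | ∃ a ∈ medialAxis M, ∃ m ∈ M, d = dist a m} ρ

/-- The image of the set `S` under the projection in direction `N` to the plane `A`: the points of
`A` that lie on a line with direction `N` through a point of `S`. -/
def projectionAlong (N : E3) (A : AffineSubspace ℝ E3) (S : Set E3) : Set E3 :=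
  {y | y ∈ A ∧ ∃ x ∈ S, ∃ t : ℝ, y = x + t • N}

/-! Fix `z` on a segment between two projected points and minimise, over `x ∈ M ∩ closedBall p R`
with `0 < R < ρ`, the length of the component `w` of `z - x` orthogonal to `N`. At a minimiser the
part of `w` tangent to `M` is a nonnegative multiple of that of `x - p`, and vanishes if `x` is
inside the ball. This makes `w` a support direction: `⟪w, y - x⟫ ≤ 0` for all `y` in the patch. Both
endpoints inherit the inequality, hence so does `z`; as `⟪w, z - x⟫ = ‖w‖²`, `w = 0` and `x` lies
over `z`.

The support inequality (`inner_sub_nonpos_of_tangential_eq`) rests on two consequences of the reach.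
Open tangent balls of radius `ρ` miss `M` (`two_mul_reach_mul_inner_le`), because nearest segments
can be extended along normals. Normals at points closer than `ρ` have inner product at least `1/2`
(`half_le_inner_normal`): at exactly 60° two tangent balls on opposite sides would meet, and the
signed distance to `M` would have both signs there. -/

open Filter Topology Metric RealInnerProductSpace

/-! ### Preliminaries from convexity and calculus -/

/-- If every direction of `K` that makes an obtuse angle with `a` makes no acute angle with `b`,
then `b` is a nonnegative multiple of `a`. -/
theorem exists_nonneg_smul_of_inner_nonpos {V : Type*} [NormedAddCommGroup V]
    [InnerProductSpace ℝ V] (K : Submodule ℝ V) {a b : V} (ha : a ∈ K) (hb : b ∈ K) (ha0 : a ≠ 0)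
    (h : ∀ v ∈ K, inner ℝ v a < 0 → inner ℝ v b ≤ 0) : ∃ μ : ℝ, 0 ≤ μ ∧ b = μ • a := by
  have hpos : 0 < inner ℝ a a := real_inner_self_pos.2 ha0
  have hab : 0 ≤ inner ℝ a b := by
    have := h (-a) (K.neg_mem ha) (by rw [inner_neg_left]; linarith)
    rw [inner_neg_left] at this
    linarith
  set μ := inner ℝ a b / inner ℝ a a with hμ
  have hμ' : μ * inner ℝ a a = inner ℝ a b := by rw [hμ]; field_simp
  refine ⟨μ, div_nonneg hab hpos.le, ?_⟩
  set c := b - μ • a with hc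
  have hca : inner ℝ c a = 0 := by
    rw [hc, inner_sub_left, real_inner_smul_left, hμ', real_inner_comm, sub_self]
  have hcc : inner ℝ c b = inner ℝ c c := by
    conv_rhs => rw [hc, inner_sub_right, ← hc, real_inner_smul_right, hca]
    simp
  -- `c` is only orthogonal to `a`; tilting it to `c - δ • a` makes the angle strictly obtuse, and
  -- `δ` is then sent to zero.
  have hle : ∀ ε : ℝ, 0 < ε → inner ℝ c c ≤ 0 + ε := by
    intro ε hε
    obtain ⟨δ, hδ, hδε⟩ : ∃ δ : ℝ, 0 < δ ∧ δ * inner ℝ a b ≤ ε := by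
      refine ⟨ε / (inner ℝ a b + 1), by positivity, ?_⟩
      rw [div_mul_eq_mul_div, div_le_iff₀ (by positivity)]
      nlinarith
    have := h (c - δ • a) (K.sub_mem (K.sub_mem hb (K.smul_mem _ ha)) (K.smul_mem _ ha)) (by
      rw [inner_sub_left, hca, real_inner_smul_left]
      have := mul_pos hδ hpos
      linarith)
    rw [inner_sub_left, real_inner_smul_left, hcc] at this
    linarith
  have h0 : inner ℝ c c ≤ 0 := le_of_forall_pos_le_add hle
  exact sub_eq_zero.1 (inner_self_eq_zero.1 (le_antisymm h0 real_inner_self_nonneg))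

theorem one_sided_deriv_nonneg {f : ℝ → ℝ} {f' : ℝ} (hf : HasDerivAt f f' 0)
    (h : ∀ᶠ t in 𝓝[>] (0 : ℝ), f 0 ≤ f t) : 0 ≤ f' := by
  have h1 := (hasDerivWithinAt_iff_tendsto_slope' (by simp)).1 (hf.hasDerivWithinAt (s := Set.Ioi 0))
  refine ge_of_tendsto h1 ?_
  filter_upwards [h, self_mem_nhdsWithin] with t ht ht0
  rw [slope_def_field]
  have : (0 : ℝ) < t := ht0
  exact div_nonneg (by linarith) (by linarith)

theorem eventually_lt_of_deriv_neg {f : ℝ → ℝ} {f' : ℝ} (hf : HasDerivAt f f' 0)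
    (h : f' < 0) : ∀ᶠ t in 𝓝[>] (0 : ℝ), f t < f 0 := by
  have h1 := (hasDerivWithinAt_iff_tendsto_slope' (by simp)).1 (hf.hasDerivWithinAt (s := Set.Ioi 0))
  filter_upwards [h1.eventually (gt_mem_nhds h), self_mem_nhdsWithin] with t ht ht0
  rw [slope_def_field] at ht
  have h0 : (0 : ℝ) < t := ht0
  rw [div_lt_iff₀ (by linarith)] at ht
  linarith

theorem exists_quadratic_taylor_bound {V W : Type*} [NormedAddCommGroup V] [NormedSpace ℝ V]
    [NormedAddCommGroup W] [NormedSpace ℝ W] {f : V → W} {x : V} (hf : ContDiffAt ℝ 2 f x) :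
    ∃ L ε : ℝ, 0 < L ∧ 0 < ε ∧
      ∀ y ∈ ball x ε, ‖f y - f x - fderiv ℝ f x (y - x)‖ ≤ L * ‖y - x‖ ^ 2 := by
  obtain ⟨L, s, hs, hL⟩ :=
    (hf.fderiv_right (m := 1) (by norm_num)).exists_lipschitzOnWith
  have hd : ∀ᶠ y in 𝓝 x, DifferentiableAt ℝ f y := by
    filter_upwards [hf.eventually (by simp)] with y hy
    exact hy.differentiableAt (by norm_num)
  obtain ⟨ε, hε, hεs⟩ := Metric.mem_nhds_iff.1 (inter_mem hs hd)
  refine ⟨L + 1, ε, by positivity, hε, fun y hy => ?_⟩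
  have hsub : closedBall x ‖y - x‖ ⊆ ball x ε :=
    closedBall_subset_ball (by simpa [dist_eq_norm] using hy)
  have := (convex_closedBall x ‖y - x‖).norm_image_sub_le_of_norm_hasFDerivWithin_le'
    (f := f) (f' := fderiv ℝ f) (φ := fderiv ℝ f x) (C := L * ‖y - x‖) (x := x) (y := y)
    ?_ ?_ ?_ ?_
  · nlinarith [sq_nonneg ‖y - x‖]
  · intro z hz
    exact (hεs (hsub hz)).2.hasFDerivAt.hasFDerivWithinAt
  · intro z hz
    have h1 := hL.dist_le_mul z (hεs (hsub hz)).1 x (hεs (mem_ball_self hε)).1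
    rw [dist_eq_norm] at h1
    refine h1.trans ?_
    gcongr
    simpa using hz
  · simp
  · simp [dist_eq_norm]

/-- A map with injective differential does not contract distances to a point too much, and its
deviation from the differential is quadratic in the image distance. -/
theorem exists_deviation_bound {W : Type*} [NormedAddCommGroup W] [NormedSpace ℝ W]
    {f : E2 → W} {x : E2} (hf : ContDiffAt ℝ 2 f x) (hinj : Function.Injective (fderiv ℝ f x)) :
    ∃ C ε : ℝ, 0 < C ∧ 0 < ε ∧
      ∀ y ∈ ball x ε, ‖f y - f x - fderiv ℝ f x (y - x)‖ ≤ C * ‖f y - f x‖ ^ 2 := by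
  obtain ⟨L, ε, hL, hε, hT⟩ := exists_quadratic_taylor_bound hf
  obtain ⟨K, hK, hAK⟩ := (LinearMap.injective_iff_antilipschitz (fderiv ℝ f x).toLinearMap).1 hinj
  have hK' : ∀ w, ‖w‖ ≤ K * ‖fderiv ℝ f x w‖ := fun w => by simpa using hAK.le_mul_dist w 0
  have hK0 : (0 : ℝ) < K := by exact_mod_cast hK
  -- For `‖y - x‖ < 1 / (2KL)` the quadratic error, multiplied by `K`, is at most `‖y - x‖ / 2` and
  -- can be absorbed, so `‖y - x‖ ≤ 2K‖f y - f x‖`.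
  refine ⟨L * (2 * K) ^ 2, min ε (1 / (2 * K * L)), by positivity,
    lt_min hε (by positivity), fun y hy => ?_⟩
  have hTy := hT y (ball_subset_ball (min_le_left _ _) hy)
  have hd : ‖y - x‖ < 1 / (2 * K * L) :=
    lt_of_lt_of_le (by simpa [dist_eq_norm] using hy) (min_le_right _ _)
  rw [lt_div_iff₀ (by positivity)] at hd
  have hk := hK' (y - x)
  have h1 : ‖fderiv ℝ f x (y - x)‖ ≤ ‖f y - f x‖ + L * ‖y - x‖ ^ 2 := by
    have := norm_sub_norm_le (fderiv ℝ f x (y - x)) (f y - f x)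
    rw [norm_sub_rev _ (f y - f x)] at this
    linarith
  have h2 : ‖y - x‖ ≤ K * (‖f y - f x‖ + L * ‖y - x‖ ^ 2) :=
    hk.trans (mul_le_mul_of_nonneg_left h1 hK0.le)
  have hbd : ‖y - x‖ ≤ 2 * K * ‖f y - f x‖ := by
    have := mul_le_mul_of_nonneg_left hd.le (norm_nonneg (y - x))
    linarith
  calc _ ≤ L * ‖y - x‖ ^ 2 := hTy
    _ ≤ L * (2 * K * ‖f y - f x‖) ^ 2 := by gcongr
    _ = _ := by ring

/-! ### Tangent planes and second-order contact -/

/-- Images of lines in a parametrization of the surface are curves in the surface. -/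
theorem exists_curve_of_chart {M V : Set E3} {U : Set E2} {X : E2 → E3} (hU : IsOpen U)
    (hX : ContDiffOn ℝ 2 X U) (hXU : X '' U = M ∩ V) {u : E2} (hu : u ∈ U) (w : E2) :
    ∃ γ : ℝ → E3, γ 0 = X u ∧ (∀ᶠ t in 𝓝 (0 : ℝ), γ t ∈ M) ∧
      HasDerivAt γ (fderiv ℝ X u w) 0 := by
  have hd : HasFDerivAt X (fderiv ℝ X u) u :=
    ((hX.contDiffAt (hU.mem_nhds hu)).differentiableAt (by norm_num)).hasFDerivAt
  have hl : HasDerivAt (fun t : ℝ => u + t • w) w 0 := by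
    simpa using ((hasDerivAt_id (0 : ℝ)).smul_const w).const_add u
  refine ⟨fun t => X (u + t • w), by simp, ?_, ?_⟩
  · have : ∀ᶠ t in 𝓝 (0 : ℝ), u + t • w ∈ U :=
      hl.continuousAt.eventually_mem (hU.mem_nhds (by simpa using hu))
    filter_upwards [this] with t ht
    exact (hXU.subset (Set.mem_image_of_mem X ht)).1
  · have hd' : HasFDerivAt X (fderiv ℝ X u) (u + (0 : ℝ) • w) := by simpa using hd
    exact hd'.comp_hasDerivAt (0 : ℝ) hl

/-- The planes `n^⊥` consist of velocities of curves in the surface. -/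
theorem exists_curve_of_inner_eq_zero {M : Set E3} (hsurf : IsC2Surface M) {q n : E3} (hq : q ∈ M)
    (hn : IsUnitNormalAt M q n) {v : E3} (hv : inner ℝ v n = 0) :
    ∃ γ : ℝ → E3, γ 0 = q ∧ (∀ᶠ t in 𝓝 (0 : ℝ), γ t ∈ M) ∧ HasDerivAt γ v 0 := by
  obtain ⟨V, -, hqV, U, X, hU, hX, hXU, -, hinj⟩ := hsurf q hq
  obtain ⟨u, hu, rfl⟩ : q ∈ X '' U := hXU ▸ ⟨hq, hqV⟩
  have hn0 : n ≠ 0 := by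
    rintro rfl
    simpa using hn.1
  have hsub : (fderiv ℝ X u).range ≤ (ℝ ∙ n)ᗮ := by
    rintro _ ⟨w, rfl⟩
    rw [Submodule.mem_orthogonal_singleton_iff_inner_left]
    exact hn.2 _ (Submodule.subset_span (exists_curve_of_chart hU hX hXU hu w))
  have hfin : Module.finrank ℝ (fderiv ℝ X u).range = Module.finrank ℝ ((ℝ ∙ n)ᗮ : Submodule ℝ E3) := by
    have h1 : Module.finrank ℝ (fderiv ℝ X u).range = 2 := by
      have := LinearMap.finrank_range_of_inj (f := (fderiv ℝ X u).toLinearMap) (hinj u hu)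
      simpa using this
    have : Fact (Module.finrank ℝ E3 = 2 + 1) := ⟨by simp⟩
    rw [h1, Submodule.finrank_orthogonal_span_singleton (n := 2) hn0]
  have heq := Submodule.eq_of_le_of_finrank_eq hsub hfin
  obtain ⟨w, rfl⟩ : v ∈ (fderiv ℝ X u).range := by
    rw [heq, Submodule.mem_orthogonal_singleton_iff_inner_left]
    exact hv
  exact exists_curve_of_chart hU hX hXU hu w

/-- A surface stays quadratically close to its tangent planes. -/
theorem exists_local_quadratic_bound {M : Set E3} (hsurf : IsC2Surface M) {q n : E3} (hq : q ∈ M)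
    (hn : IsUnitNormalAt M q n) :
    ∃ C δ : ℝ, 0 < C ∧ 0 < δ ∧ ∀ m ∈ M, ‖m - q‖ < δ → inner ℝ (m - q) n ≤ C * ‖m - q‖ ^ 2 := by
  obtain ⟨V, hV, hqV, U, X, hU, hX, hXU, hemb, hinj⟩ := hsurf q hq
  obtain ⟨u, hu, rfl⟩ : q ∈ X '' U := hXU ▸ ⟨hq, hqV⟩
  obtain ⟨C, ε, hC, hε, hdev⟩ :=
    exists_deviation_bound (hX.contDiffAt (hU.mem_nhds hu)) (hinj u hu)
  -- The embedding property turns closeness in space into closeness of parameters, so no other sheet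
  -- of the surface comes near `q`.
  have hsmall : {u' : U | (u' : E2) ∈ ball u ε} ∈ 𝓝 (⟨u, hu⟩ : U) :=
    continuous_subtype_val.continuousAt.preimage_mem_nhds (ball_mem_nhds u hε)
  rw [hemb.isInducing.nhds_eq_comap, mem_comap] at hsmall
  obtain ⟨W, hW, hWs⟩ := hsmall
  obtain ⟨δ, hδ, hδW⟩ := Metric.mem_nhds_iff.1 (inter_mem hW (hV.mem_nhds hqV))
  refine ⟨C, δ, hC, hδ, fun m hm hmδ => ?_⟩
  have hmW := hδW (by simpa [dist_eq_norm] using hmδ : m ∈ ball (X u) δ)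
  obtain ⟨u', hu', rfl⟩ : m ∈ X '' U := hXU ▸ ⟨hm, hmW.2⟩
  have hball : (⟨u', hu'⟩ : U) ∈ {u' : U | (u' : E2) ∈ ball u ε} :=
    hWs (show (⟨u', hu'⟩ : U) ∈ (fun u : U => X u) ⁻¹' W from hmW.1)
  have hAn : inner ℝ (fderiv ℝ X u (u' - u)) n = 0 :=
    hn.2 _ (Submodule.subset_span (exists_curve_of_chart hU hX hXU hu _))
  calc inner ℝ (X u' - X u) n = inner ℝ (X u' - X u - fderiv ℝ X u (u' - u)) n := by
        rw [inner_sub_left (X u' - X u), hAn, sub_zero]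
    _ ≤ ‖X u' - X u - fderiv ℝ X u (u' - u)‖ * ‖n‖ := real_inner_le_norm _ _
    _ ≤ C * ‖X u' - X u‖ ^ 2 := by rw [hn.1, mul_one]; exact hdev u' hball

/-! ### Nearest points and tangent balls -/

/-- Points at distance less than `ρ` from `M` have at most one nearest point on `M`. -/
def HasUniqueNearest (M : Set E3) (ρ : ℝ) : Prop :=
  ∀ a, infDist a M < ρ → ∀ m ∈ M, ∀ m' ∈ M,
    dist a m = infDist a M → dist a m' = infDist a M → m = m'

/-- `π` selects a nearest point of `M`. -/
def IsNearestMap (M : Set E3) (π : E3 → E3) : Prop :=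
  ∀ a, π a ∈ M ∧ dist a (π a) = infDist a M

theorem IsReach.hasUniqueNearest {M : Set E3} {ρ : ℝ} (h : IsReach M ρ) :
    HasUniqueNearest M ρ := by
  intro a ha m hm m' hm' h1 h2
  by_contra hne
  have := h.1 ⟨a, ⟨m, hm, m', hm', hne, h1, h2⟩, m, hm, rfl⟩
  linarith

theorem exists_isNearestMap {M : Set E3} (hM : IsCompact M) (hne : M.Nonempty) :
    ∃ π, IsNearestMap M π := by
  have : ∀ a, ∃ m, m ∈ M ∧ dist a m = infDist a M := fun a => by
    obtain ⟨m, hm, h⟩ := hM.exists_infDist_eq_dist hne a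
    exact ⟨m, hm, h.symm⟩
  choose π hπ using this
  exact ⟨π, hπ⟩

theorem IsNearestMap.dist_le {M : Set E3} {π : E3 → E3} (hπ : IsNearestMap M π) (a : E3) {m : E3}
    (hm : m ∈ M) : dist a (π a) ≤ dist a m := (hπ a).2 ▸ infDist_le_dist_of_mem hm

/-- By compactness it suffices that every cluster point of `π b` as `b → a` is a nearest point of
`a`; uniqueness then identifies it with `π a`. -/
theorem IsNearestMap.continuousAt {M : Set E3} (hM : IsCompact M) {π : E3 → E3}
    (hπ : IsNearestMap M π) {ρ : ℝ} (hu : HasUniqueNearest M ρ) {a : E3} (ha : infDist a M < ρ) :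
    ContinuousAt π a := by
  refine hM.tendsto_nhds_of_unique_mapClusterPt (Eventually.of_forall fun b => (hπ b).1) ?_
  intro m hm hcl
  refine hu a ha m hm _ (hπ a).1 (le_antisymm ?_ (infDist_le_dist_of_mem hm)) (hπ a).2
  refine le_of_forall_pos_le_add fun ε hε => ?_
  have hev : ∀ᶠ b in 𝓝 a, π b ∈ closedBall a (infDist a M + ε) := by
    filter_upwards [ball_mem_nhds a (half_pos hε)] with b hb
    rw [mem_ball] at hb
    rw [mem_closedBall]
    have h1 := (hπ b).2
    have h2 := infDist_le_infDist_add_dist (s := M) (x := b) (y := a)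
    have h3 := dist_triangle (π b) b a
    rw [dist_comm (π b) b] at h3
    linarith
  have := isClosed_closedBall.mem_of_mapClusterPt hcl hev
  rwa [mem_closedBall, dist_comm] at this

/-- A nearest segment extends beyond its far end, as long as it stays in the tube of radius `ρ`. -/
theorem infDist_extend {M : Set E3} (hM : IsCompact M) {π : E3 → E3} (hπ : IsNearestMap M π)
    {ρ : ℝ} (hu : HasUniqueNearest M ρ) {q n : E3} (hq : q ∈ M) (hn : ‖n‖ = 1) {t ε : ℝ}
    (ht : 0 < t) (htd : infDist (q + t • n) M = t) (hε : 0 < ε) (hεt : ε ≤ t) (hlt : t + ε < ρ) :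
    infDist (q + (t + ε) • n) M = t + ε := by
  set x := q + t • n with hx
  -- The far end of the extended segment is found as a maximiser of the distance to `M` over a small
  -- ball around `x`.
  obtain ⟨y, hy, hmax⟩ := (isCompact_closedBall x ε).exists_isMaxOn ⟨x, mem_closedBall_self hε.le⟩
    (continuous_infDist_pt M).continuousOn
  have hxy : t ≤ infDist y M := htd ▸ hmax (mem_closedBall_self hε.le)
  have hyx : ‖y - x‖ ≤ ε := by simpa [dist_eq_norm] using hy
  have hyρ : infDist y M < ρ := by
    have := infDist_le_infDist_add_dist (s := M) (x := y) (y := x)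
    rw [dist_eq_norm] at this
    linarith
  have hcont := hπ.continuousAt hM hu hyρ
  -- First variation without differentiating the distance: `y` and `y + s • v` are compared with the
  -- same point `π (y + s • v)`, and continuity of `π` handles `s → 0`.
  have key : ∀ v, (∀ᶠ s in 𝓝[>] (0 : ℝ), y + s • v ∈ closedBall x ε) →
      inner ℝ v (y - π y) ≤ 0 := by
    intro v hv
    have hline : Tendsto (fun s : ℝ => y + s • v) (𝓝[>] 0) (𝓝 y) := by
      have : Continuous fun s : ℝ => y + s • v := by fun_prop
      simpa using (this.tendsto 0).mono_left nhdsWithin_le_nhds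
    have hlim : Tendsto (fun s : ℝ => 2 * inner ℝ v (y - π (y + s • v)) + s * ‖v‖ ^ 2) (𝓝[>] 0)
        (𝓝 (2 * inner ℝ v (y - π y) + 0 * ‖v‖ ^ 2)) := by
      refine Tendsto.add (Tendsto.const_mul 2 (tendsto_const_nhds.inner
        (tendsto_const_nhds.sub (hcont.tendsto.comp hline)))) (Tendsto.mul_const _ ?_)
      exact tendsto_id.mono_left nhdsWithin_le_nhds
    have hle : 2 * inner ℝ v (y - π y) + 0 * ‖v‖ ^ 2 ≤ 0 := by
      refine le_of_tendsto hlim ?_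
      filter_upwards [hv, self_mem_nhdsWithin] with s hs hs0
      have hs0 : 0 < s := hs0
      have h1 : infDist (y + s • v) M ≤ infDist y M := hmax hs
      rw [← (hπ (y + s • v)).2] at h1
      have h2 := h1.trans (infDist_le_dist_of_mem (hπ (y + s • v)).1)
      rw [dist_eq_norm, dist_eq_norm, add_sub_right_comm] at h2
      have h3 := pow_le_pow_left₀ (norm_nonneg _) h2 2
      rw [norm_add_sq_real, inner_smul_right, norm_smul, mul_pow, Real.norm_eq_abs, sq_abs,
        real_inner_comm] at h3
      by_contra! hcon
      nlinarith [mul_pos hs0 hcon]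
    linarith
  have hyM : y - π y ≠ 0 := by
    intro h0
    have := (hπ y).2
    rw [dist_eq_norm, h0, norm_zero] at this
    linarith
  have hin : ∀ v, inner ℝ v (y - x) < 0 → ∀ᶠ s in 𝓝[>] (0 : ℝ), y + s • v ∈ closedBall x ε := by
    intro v hv
    have hd : HasDerivAt (fun s : ℝ => ‖(y - x) + s • v‖ ^ 2) (2 * inner ℝ (y - x) v) 0 := by
      have hl : HasDerivAt (fun s : ℝ => (y - x) + s • v) v 0 := by
        simpa using ((hasDerivAt_id (0 : ℝ)).smul_const v).const_add (y - x)
      simpa using hl.norm_sq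
    rw [real_inner_comm] at hd
    filter_upwards [eventually_lt_of_deriv_neg hd (by linarith)] with s hs
    rw [mem_closedBall, dist_eq_norm, add_sub_right_comm]
    simp only [zero_smul, add_zero] at hs
    exact (lt_of_pow_lt_pow_left₀ 2 (norm_nonneg _) hs).le.trans hyx
  have hbd : ‖y - x‖ = ε := by
    by_contra hne
    have hlt' : y ∈ ball x ε := by
      rw [mem_ball, dist_eq_norm]
      exact lt_of_le_of_ne hyx hne
    have := key (y - π y) (by
      have hline : ContinuousAt (fun s : ℝ => y + s • (y - π y)) 0 := by fun_prop
      have hmem := hline.eventually_mem (isOpen_ball.mem_nhds (x := y + (0 : ℝ) • (y - π y))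
        (by simpa using hlt'))
      exact (hmem.mono fun s hs => ball_subset_closedBall hs).filter_mono nhdsWithin_le_nhds)
    exact hyM (inner_self_eq_zero.1 (le_antisymm this real_inner_self_nonneg))
  have hyx0 : y - x ≠ 0 := by
    rw [← norm_pos_iff, hbd]
    exact hε
  obtain ⟨μ, hμ, hμe⟩ := exists_nonneg_smul_of_inner_nonpos (V := E3) ⊤ (a := y - x)
    (b := y - π y) trivial trivial hyx0 (fun v _ hv => key v (hin v hv))
  have hnorm : infDist y M = μ * ε := by
    rw [← (hπ y).2, dist_eq_norm, hμe, norm_smul, hbd, Real.norm_of_nonneg hμ]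
  -- Since `μ * ε = infDist y M ≥ t ≥ ε`, the point `x` lies between `π y` and `y`; so `π y` is also
  -- nearest to `x` and equals `q`.
  have hμ1 : 1 ≤ μ := by
    by_contra! hcon
    nlinarith
  have hxπ : dist x (π y) = infDist y M - ε := by
    have : x - π y = (μ - 1) • (y - x) := by
      rw [sub_smul, one_smul, ← hμe]
      abel
    rw [dist_eq_norm, this, norm_smul, hbd, Real.norm_of_nonneg (by linarith), hnorm]
    ring
  have hdx : infDist y M - ε = t := by
    refine le_antisymm ?_ ?_
    · have := infDist_le_infDist_add_dist (s := M) (x := y) (y := x)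
      rw [dist_eq_norm, hbd] at this
      linarith
    · rw [← hxπ, ← htd]
      exact infDist_le_dist_of_mem (hπ y).1
  have hπq : π y = q := by
    refine hu x (by linarith) _ (hπ y).1 _ hq (by linarith) ?_
    rw [htd, hx, dist_eq_norm, add_sub_cancel_left, norm_smul, hn, Real.norm_of_nonneg ht.le,
      mul_one]
  have hyq : y = q + (t + ε) • n := by
    have hμε : μ * ε = t + ε := by linarith
    have h1 : (μ - 1) • (y - q) = μ • (t • n) := by
      have h2 : y - q = μ • (y - q - t • n) := by
        rw [hπq] at hμe
        conv_lhs => rw [hμe, hx]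
        congr 1
        abel
      rw [smul_sub] at h2
      rw [sub_smul, one_smul]
      nth_rewrite 2 [h2]
      abel
    have hμ0 : μ - 1 ≠ 0 := by
      intro h0
      have : μ = 1 := by linarith
      rw [this] at hμε
      linarith
    have h3 : y - q = (t + ε) • n := by
      refine smul_right_injective E3 hμ0 ?_
      simp only
      rw [h1, smul_smul, smul_smul]
      congr 1
      linarith
    rw [← h3]
    abel
  rw [← hyq]
  linarith

theorem dist_add_smul_sq {V : Type*} [NormedAddCommGroup V] [InnerProductSpace ℝ V] {n : V}
    (hn : ‖n‖ = 1) (q m : V) (t : ℝ) :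
    dist (q + t • n) m ^ 2 = ‖m - q‖ ^ 2 - 2 * t * inner ℝ (m - q) n + t ^ 2 := by
  have : q + t • n - m = t • n - (m - q) := by abel
  rw [dist_eq_norm, this, norm_sub_sq_real, norm_smul, hn, real_inner_smul_left,
    real_inner_comm, Real.norm_eq_abs, mul_one, sq_abs]
  ring

theorem infDist_add_smul_eq {M : Set E3} {q n : E3} (hq : q ∈ M) (hn : ‖n‖ = 1) {t : ℝ}
    (ht : 0 ≤ t) :
    infDist (q + t • n) M = t ↔ ∀ m ∈ M, 2 * t * inner ℝ (m - q) n ≤ ‖m - q‖ ^ 2 := by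
  have hexp := fun m => dist_add_smul_sq hn q m t
  constructor
  · intro h m hm
    have h1 : t ≤ dist (q + t • n) m :=
      h.symm.le.trans (infDist_le_dist_of_mem hm)
    have := pow_le_pow_left₀ ht h1 2
    rw [hexp] at this
    linarith
  · intro h
    refine le_antisymm ?_ ((le_infDist ⟨q, hq⟩).2 fun m hm => ?_)
    · refine (infDist_le_dist_of_mem hq).trans_eq ?_
      rw [dist_eq_norm, add_sub_cancel_left, norm_smul, hn, Real.norm_of_nonneg ht, mul_one]
    · refine le_of_sq_le_sq ?_ dist_nonneg
      rw [hexp]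
      linarith [h m hm]

/-- Near `q` the quadratic bound suffices for `t ≤ 1 / (2C)`; at distance at least `δ ≥ 2t`,
Cauchy–Schwarz does. -/
theorem exists_touching_ball {M : Set E3} (hsurf : IsC2Surface M) {q n : E3} (hq : q ∈ M)
    (hn : IsUnitNormalAt M q n) :
    ∃ t : ℝ, 0 < t ∧ ∀ m ∈ M, 2 * t * inner ℝ (m - q) n ≤ ‖m - q‖ ^ 2 := by
  obtain ⟨C, δ, hC, hδ, h⟩ := exists_local_quadratic_bound hsurf hq hn
  refine ⟨min (1 / (2 * C)) (δ / 2), lt_min (by positivity) (by positivity), fun m hm => ?_⟩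
  set t := min (1 / (2 * C)) (δ / 2) with ht
  have ht0 : 0 ≤ t := (lt_min (by positivity) (by positivity)).le
  have ht1 : t * (2 * C) ≤ 1 := (le_div_iff₀ (by positivity)).1 (min_le_left _ _)
  have ht2 : t ≤ δ / 2 := min_le_right _ _
  rcases lt_or_ge ‖m - q‖ δ with hlt | hge
  · have h1 := mul_le_mul_of_nonneg_left (h m hm hlt) (by linarith : 0 ≤ 2 * t)
    nlinarith [sq_nonneg ‖m - q‖]
  · have h1 := real_inner_le_norm (m - q) n
    rw [hn.1, mul_one] at h1
    have h2 := mul_le_mul_of_nonneg_left h1 (by linarith : 0 ≤ 2 * t)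
    nlinarith [norm_nonneg (m - q)]

/-- The open balls of radius `ρ` that are tangent to the surface contain no point of it. -/
theorem two_mul_reach_mul_inner_le {M : Set E3} (hsurf : IsC2Surface M) (hM : IsCompact M) {ρ : ℝ}
    (hρ : 0 < ρ) (hu : HasUniqueNearest M ρ) {q n : E3} (hq : q ∈ M) (hn : IsUnitNormalAt M q n)
    {m : E3} (hm : m ∈ M) : 2 * ρ * inner ℝ (m - q) n ≤ ‖m - q‖ ^ 2 := by
  obtain ⟨π, hπ⟩ := exists_isNearestMap hM ⟨q, hq⟩
  obtain ⟨t₀, ht₀, hT⟩ := exists_touching_ball hsurf hq hn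
  have hmono : ∀ s t : ℝ, 0 ≤ s → s ≤ t → (∀ m ∈ M, 2 * t * inner ℝ (m - q) n ≤ ‖m - q‖ ^ 2) →
      ∀ m ∈ M, 2 * s * inner ℝ (m - q) n ≤ ‖m - q‖ ^ 2 := by
    intro s t hs hst ht m hm
    rcases le_total 0 (inner ℝ (m - q) n) with h0 | h0
    · exact (mul_le_mul_of_nonneg_right (by linarith) h0).trans (ht m hm)
    · nlinarith [sq_nonneg ‖m - q‖]
  -- Extending by `ε = t` doubles the radius of a touching ball, so finitely many doublings of `t₀`
  -- reach any radius below `ρ`; `ρ` itself is a limit.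
  have hstep : ∀ k : ℕ, ∀ t : ℝ, 0 < t → t < ρ → t ≤ 2 ^ k * t₀ →
      ∀ m ∈ M, 2 * t * inner ℝ (m - q) n ≤ ‖m - q‖ ^ 2 := by
    intro k
    induction k with
    | zero => exact fun t h0 _ hle => hmono t t₀ h0.le (by simpa using hle) hT
    | succ k ih =>
      intro t h0 hlt hle
      have hhalf := (infDist_add_smul_eq hq hn.1 (by linarith : 0 ≤ t / 2)).2
        (ih (t / 2) (by linarith) (by linarith) (by rw [pow_succ] at hle; linarith))
      have := infDist_extend hM hπ hu hq hn.1 (by linarith) hhalf (by linarith : 0 < t / 2) le_rfl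
        (by linarith)
      rw [add_halves] at this
      exact (infDist_add_smul_eq hq hn.1 h0.le).1 this
  have hall : ∀ t : ℝ, 0 < t → t < ρ → 2 * t * inner ℝ (m - q) n ≤ ‖m - q‖ ^ 2 := by
    intro t h0 hlt
    obtain ⟨k, hk⟩ := pow_unbounded_of_one_lt (t / t₀) (one_lt_two)
    rw [div_lt_iff₀ ht₀] at hk
    exact hstep k t h0 hlt hk.le m hm
  have hlim : Tendsto (fun t : ℝ => 2 * t * inner ℝ (m - q) n) (𝓝[<] ρ)
      (𝓝 (2 * ρ * inner ℝ (m - q) n)) := by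
    have : Continuous fun t : ℝ => 2 * t * inner ℝ (m - q) n := by fun_prop
    exact (this.tendsto ρ).mono_left nhdsWithin_le_nhds
  refine le_of_tendsto hlim ?_
  filter_upwards [Ioo_mem_nhdsLT hρ] with t ht
  exact hall t ht.1 ht.2

/-! ### Signed distance and the angle between normals -/

theorem IsUnitNormalAt.neg {M : Set E3} {p N : E3} (h : IsUnitNormalAt M p N) :
    IsUnitNormalAt M p (-N) :=
  ⟨by rw [norm_neg, h.1], Submodule.neg_mem _ h.2⟩

/-- The segment from a point to its nearest point is parallel to the normal there. -/
theorem sub_nearest_eq_smul_normal {M : Set E3} (hsurf : IsC2Surface M) {π : E3 → E3}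
    (hπ : IsNearestMap M π) {a n : E3} (hn : IsUnitNormalAt M (π a) n) :
    a - π a = inner ℝ (a - π a) n • n := by
  set v := (a - π a) - inner ℝ (a - π a) n • n with hv
  have hvn : inner ℝ v n = 0 := by
    rw [hv, inner_sub_left, real_inner_smul_left, real_inner_self_eq_norm_sq, hn.1]
    ring
  have key : ∀ w, inner ℝ w n = 0 → inner ℝ w (a - π a) ≤ 0 := by
    intro w hw
    obtain ⟨γ, h0, hγM, hγ⟩ := exists_curve_of_inner_eq_zero hsurf (hπ a).1 hn hw
    have hd : HasDerivAt (fun t => ‖γ t - a‖ ^ 2) (2 * inner ℝ (γ 0 - a) w) 0 :=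
      (hγ.sub_const a).norm_sq
    have := one_sided_deriv_nonneg hd (by
      filter_upwards [hγM.filter_mono nhdsWithin_le_nhds] with t ht
      have := hπ.dist_le a ht
      rw [dist_comm, dist_comm a, dist_eq_norm, dist_eq_norm] at this
      rw [h0]
      exact pow_le_pow_left₀ (norm_nonneg _) this 2)
    rw [h0, ← neg_sub a, inner_neg_left, real_inner_comm] at this
    linarith
  have h1 := key v hvn
  have h2 : inner ℝ v v = inner ℝ v (a - π a) := by
    conv_lhs => rw [hv, inner_sub_right, ← hv, inner_smul_right, hvn, mul_zero, sub_zero]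
  exact sub_eq_zero.1 (inner_self_eq_zero.1 (le_antisymm (h2 ▸ h1) real_inner_self_nonneg))

/-- The signed distance is positive on the part of a tangent ball near its point of contact. -/
theorem signed_dist_pos {M : Set E3} (hsurf : IsC2Surface M) (hM : IsCompact M) {ρ : ℝ}
    (hρ : 0 < ρ) (hu : HasUniqueNearest M ρ) {π ν : E3 → E3} (hπ : IsNearestMap M π)
    (hνc : ContinuousOn ν M) (hν : ∀ q ∈ M, IsUnitNormalAt M q (ν q)) {q y : E3} (hq : q ∈ M)
    (hyq : y ∈ ball q ρ) (hyν : y ∈ ball (q + ρ • ν q) ρ) :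
    0 < inner ℝ (y - π y) (ν (π y)) := by
  set C := ball q ρ ∩ ball (q + ρ • ν q) ρ with hC
  have htube : ∀ y ∈ C, infDist y M < ρ := fun y hy =>
    (infDist_le_dist_of_mem hq).trans_lt hy.1
  have hcont : ContinuousOn (fun y => inner ℝ (y - π y) (ν (π y))) C := by
    intro y hy
    have h1 := hπ.continuousAt hM hu (htube y hy)
    have h2 : ContinuousAt (fun z => ν (π z)) y :=
      ((hνc (π y) (hπ y).1).tendsto.comp (tendsto_nhdsWithin_iff.2
        ⟨h1, Eventually.of_forall fun z => (hπ z).1⟩))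
    exact ((continuousAt_id.sub h1).inner h2).continuousWithinAt
  -- A zero would be a point of `M` inside a tangent ball. On the convex set `C` the sign is
  -- therefore constant, and `z` on the normal shows that it is positive.
  have hne : ∀ y ∈ C, inner ℝ (y - π y) (ν (π y)) ≠ (0 : ℝ) := by
    intro y hy h0
    have h1 := sub_nearest_eq_smul_normal hsurf hπ (hν _ (hπ y).1)
    rw [h0, zero_smul, sub_eq_zero] at h1
    have hyM : y ∈ M := h1 ▸ (hπ y).1
    have h2 := two_mul_reach_mul_inner_le hsurf hM hρ hu hq (hν q hq) hyM
    have h3 := pow_lt_pow_left₀ (mem_ball'.1 hy.2) dist_nonneg two_ne_zero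
    rw [dist_add_smul_sq (hν q hq).1] at h3
    linarith
  have hpre : IsPreconnected C := ((convex_ball _ _).inter (convex_ball _ _)).isPreconnected
  set z := q + (ρ / 2) • ν q with hz
  have hhalf := (infDist_add_smul_eq hq (hν q hq).1 (half_pos hρ).le).2 (by
    intro m hm
    have := two_mul_reach_mul_inner_le hsurf hM hρ hu hq (hν q hq) hm
    nlinarith [sq_nonneg ‖m - q‖])
  have hdz : dist z q = ρ / 2 := by
    rw [hz, dist_eq_norm, add_sub_cancel_left, norm_smul, (hν q hq).1,
      Real.norm_of_nonneg (half_pos hρ).le, mul_one]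
  have hπz : π z = q := hu z (by rw [hhalf]; linarith) _ (hπ z).1 _ hq (hπ z).2 (by
    rw [hdz, hhalf])
  have hzC : z ∈ C := by
    refine ⟨mem_ball.2 (by rw [hdz]; linarith), mem_ball.2 ?_⟩
    have : z - (q + ρ • ν q) = (-(ρ / 2)) • ν q := by
      rw [hz, add_sub_add_left_eq_sub, ← sub_smul]
      congr 1
      ring
    rw [dist_eq_norm, this, norm_smul, (hν q hq).1, norm_neg,
      Real.norm_of_nonneg (half_pos hρ).le]
    linarith
  have hzpos : 0 < inner ℝ (z - π z) (ν (π z)) := by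
    rw [hπz, hz, add_sub_cancel_left, real_inner_smul_left, real_inner_self_eq_norm_sq,
      (hν q hq).1]
    linarith
  by_contra! hcon
  obtain ⟨w, hw, hw0⟩ := hpre.intermediate_value ⟨hyq, hyν⟩ hzC hcont ⟨hcon, hzpos.le⟩
  exact hne w hw hw0

/-- Two vectors of length one at an angle of sixty degrees: geometry of tangent balls on opposite
sides. -/
theorem midpoint_mem_balls {V : Type*} [NormedAddCommGroup V] [InnerProductSpace ℝ V]
    {p m N n : V} {ρ : ℝ} (hN : ‖N‖ = 1) (hn : ‖n‖ = 1) (hpm : ‖m - p‖ < ρ)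
    (hNn : inner ℝ N n = 1 / 2) (hs : 0 ≤ inner ℝ (m - p) (N + n)) :
    ∃ y, y ∈ ball p ρ ∧ y ∈ ball (p + ρ • N) ρ ∧ y ∈ ball m ρ ∧ y ∈ ball (m - ρ • n) ρ := by
  have hρ : 0 < ρ := (norm_nonneg _).trans_lt hpm
  have hdiff : ‖N - n‖ = 1 := by
    have := norm_sub_sq_real N n
    rw [hN, hn, hNn] at this
    have h0 := norm_nonneg (N - n)
    nlinarith
  have hsum : ‖N + n‖ ^ 2 = 3 := by
    rw [norm_add_sq_real, hN, hn, hNn]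
    norm_num
  -- The centres are closer than `2ρ` because `‖m - p‖² + 3ρ² < 4ρ²`; the witness below is their
  -- midpoint.
  have hcent : ‖(m - p) - ρ • (N + n)‖ < 2 * ρ := by
    refine lt_of_pow_lt_pow_left₀ 2 (by linarith) ?_
    rw [norm_sub_sq_real, inner_smul_right, norm_smul, mul_pow, hsum, Real.norm_of_nonneg hρ.le]
    have := pow_lt_pow_left₀ hpm (norm_nonneg _) two_ne_zero
    nlinarith [mul_nonneg hρ.le hs]
  have hnear : ∀ s : ℝ, ‖s‖ = 1 / 2 → ‖s • (m - p) + (ρ / 2) • (N - n)‖ < ρ := by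
    intro s hs
    refine (norm_add_le _ _).trans_lt ?_
    rw [norm_smul, norm_smul, hdiff, hs, Real.norm_of_nonneg (half_pos hρ).le]
    linarith
  have hfar : ∀ s : ℝ, ‖s‖ = 1 / 2 → ‖s • ((m - p) - ρ • (N + n))‖ < ρ := by
    intro s hs
    rw [norm_smul, hs]
    linarith
  refine ⟨(1 / 2 : ℝ) • (p + m) + (ρ / 2) • (N - n), ?_, ?_, ?_, ?_⟩
  · rw [mem_ball, dist_eq_norm]
    refine lt_of_eq_of_lt (congrArg norm ?_) (hnear (1 / 2) (by norm_num))
    module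
  · rw [mem_ball, dist_eq_norm]
    refine lt_of_eq_of_lt (congrArg norm ?_) (hfar (1 / 2) (by norm_num))
    module
  · rw [mem_ball, dist_eq_norm]
    refine lt_of_eq_of_lt (congrArg norm ?_) (hnear (-(1 / 2)) (by norm_num))
    module
  · rw [mem_ball, dist_eq_norm]
    refine lt_of_eq_of_lt (congrArg norm ?_) (hfar (-(1 / 2)) (by norm_num))
    module

/-- The common point of the four balls would have positive signed distance as seen from `p` and
negative as seen from `m`. Replacing `ν` by `-ν` arranges the sign condition on `m - p`. -/
theorem inner_normal_ne_half {M : Set E3} (hsurf : IsC2Surface M) (hM : IsCompact M) {ρ : ℝ}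
    (hu : HasUniqueNearest M ρ) {ν : E3 → E3}
    (hνc : ContinuousOn ν M) (hν : ∀ q ∈ M, IsUnitNormalAt M q (ν q)) {p m : E3} (hp : p ∈ M)
    (hm : m ∈ M) (hpm : ‖m - p‖ < ρ) : inner ℝ (ν p) (ν m) ≠ (1 / 2 : ℝ) := by
  have hρ : 0 < ρ := (norm_nonneg _).trans_lt hpm
  obtain ⟨π, hπ⟩ := exists_isNearestMap hM ⟨p, hp⟩
  have main : ∀ ν : E3 → E3, ContinuousOn ν M → (∀ q ∈ M, IsUnitNormalAt M q (ν q)) →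
      inner ℝ (ν p) (ν m) = (1 / 2 : ℝ) → 0 ≤ inner ℝ (m - p) (ν p + ν m) → False := by
    intro ν hνc hν h hs
    obtain ⟨y, h1, h2, h3, h4⟩ := midpoint_mem_balls (hν p hp).1 (hν m hm).1 hpm h hs
    have hpos := signed_dist_pos hsurf hM hρ hu hπ hνc hν hp h1 h2
    have hneg := signed_dist_pos hsurf hM hρ hu hπ (ν := fun x => -ν x) hνc.neg
      (fun q hq => (hν q hq).neg) hm h3 (by rwa [smul_neg, ← sub_eq_add_neg])
    rw [inner_neg_right] at hneg
    linarith
  intro h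
  rcases le_total 0 (inner ℝ (m - p) (ν p + ν m)) with hs | hs
  · exact main ν hνc hν h hs
  · refine main (fun x => -ν x) hνc.neg (fun q hq => (hν q hq).neg) (by simpa using h) ?_
    rw [← neg_add, inner_neg_right]
    linarith

/-- Normals at points at distance less than the reach make an angle of less than sixty degrees. -/
theorem half_le_inner_normal {M : Set E3} (hsurf : IsC2Surface M) (hM : IsCompact M) {ρ : ℝ}
    (hu : HasUniqueNearest M ρ) {ν : E3 → E3}
    (hνc : ContinuousOn ν M) (hν : ∀ q ∈ M, IsUnitNormalAt M q (ν q)) {p x : E3} (hp : p ∈ M)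
    (hx : x ∈ M) (hpx : ‖x - p‖ < ρ) : 1 / 2 ≤ inner ℝ (ν p) (ν x) := by
  obtain ⟨π, hπ⟩ := exists_isNearestMap hM ⟨p, hp⟩
  have hfix : ∀ a ∈ M, π a = a := by
    intro a ha
    have := (hπ a).2
    rw [infDist_zero_of_mem ha] at this
    exact (dist_eq_zero.1 this).symm
  -- The segment from `p` to `x`, pushed to `M` by `π`, stays within `‖x - p‖ < ρ` of `p`. Along it
  -- the inner product starts at `1` and cannot cross `1/2`.
  set a : ℝ → E3 := fun t => p + t • (x - p) with ha
  have hap : ∀ t ∈ Set.Icc (0 : ℝ) 1, dist (a t) p = t * ‖x - p‖ := by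
    intro t ht
    rw [ha, dist_eq_norm, add_sub_cancel_left, norm_smul, Real.norm_of_nonneg ht.1]
  have hax : ∀ t ∈ Set.Icc (0 : ℝ) 1, dist (a t) x = (1 - t) * ‖x - p‖ := by
    intro t ht
    have : a t - x = (-(1 - t)) • (x - p) := by
      simp only [ha]
      module
    rw [dist_eq_norm, this, norm_smul, norm_neg, Real.norm_of_nonneg (by linarith [ht.2])]
  have htube : ∀ t ∈ Set.Icc (0 : ℝ) 1, infDist (a t) M < ρ := by
    intro t ht
    refine (infDist_le_dist_of_mem hp).trans_lt ?_
    rw [hap t ht]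
    nlinarith [norm_nonneg (x - p), ht.2]
  have hnear : ∀ t ∈ Set.Icc (0 : ℝ) 1, ‖π (a t) - p‖ < ρ := by
    intro t ht
    have h1 := hπ.dist_le (a t) hx
    have h2 := dist_triangle (π (a t)) (a t) p
    rw [hax t ht] at h1
    rw [hap t ht, dist_comm (π (a t)) (a t), dist_eq_norm (π (a t))] at h2
    linarith
  have hcont : ContinuousOn (fun t => inner ℝ (ν p) (ν (π (a t)))) (Set.Icc (0 : ℝ) 1) := by
    intro t ht
    have hac : ContinuousAt a t := by fun_prop
    have h1 : ContinuousAt (fun t => π (a t)) t :=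
      ContinuousAt.comp (f := a) (hπ.continuousAt hM hu (htube t ht)) hac
    have h2 : ContinuousAt (fun t => ν (π (a t))) t :=
      ((hνc (π (a t)) (hπ (a t)).1).tendsto.comp (tendsto_nhdsWithin_iff.2
        ⟨h1, Eventually.of_forall fun z => (hπ (a z)).1⟩))
    exact (continuousAt_const.inner h2).continuousWithinAt
  have h0 : inner ℝ (ν p) (ν (π (a 0))) = (1 : ℝ) := by
    have : a 0 = p := by simp [ha]
    rw [this, hfix p hp, real_inner_self_eq_norm_sq, (hν p hp).1, one_pow]
  have h1 : π (a 1) = x := by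
    have : a 1 = x := by simp [ha]
    rw [this, hfix x hx]
  by_contra! hcon
  obtain ⟨t, ht, hte⟩ := intermediate_value_Icc' zero_le_one hcont
    (show (1 / 2 : ℝ) ∈ _ from ⟨by simpa only [h1] using hcon.le, by rw [h0]; norm_num⟩)
  exact inner_normal_ne_half hsurf hM hu hνc hν hp (hπ (a t)).1 (hnear t ht) hte

/-! ### Support inequality and minimisation -/

/-- The supporting line inequality at a point `x` of the projected patch: if the tangential parts of
`w` and `x - p` are parallel, `w` supports the projection of the points no farther from `p`. -/
theorem inner_sub_nonpos_of_tangential_eq {V : Type*} [NormedAddCommGroup V]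
    [InnerProductSpace ℝ V] {p x y N n w : V} {ρ μ : ℝ}
    (hcos : 1 / 2 ≤ inner ℝ N n) (hh : |inner ℝ (x - p) N| ≤ ρ / 2)
    (hwN : inner ℝ w N = 0) (hμ : 0 ≤ μ)
    (hw : w - inner ℝ w n • n = μ • ((x - p) - inner ℝ (x - p) n • n))
    (hy : ‖y - p‖ ≤ ‖x - p‖) (hyn : 2 * ρ * |inner ℝ (y - x) n| ≤ ‖y - x‖ ^ 2) :
    inner ℝ w (y - x) ≤ 0 := by
  have hw' : w = μ • ((x - p) - inner ℝ (x - p) n • n) + inner ℝ w n • n := by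
    rw [← hw]
    abel
  set α := inner ℝ w n
  set β := inner ℝ (x - p) n
  set c := inner ℝ N n
  set h := inner ℝ (x - p) N
  set e := inner ℝ (y - x) n
  have h1 : 0 = μ * (h - β * c) + α * c := by
    rw [← hwN]
    conv_lhs => rw [hw']
    rw [inner_add_left, real_inner_smul_left, inner_sub_left, real_inner_smul_left,
      real_inner_smul_left, real_inner_comm N n]
  have h2 : inner ℝ w (y - x) = μ * (inner ℝ (x - p) (y - x) - β * e) + α * e := by
    conv_lhs => rw [hw']
    rw [inner_add_left, real_inner_smul_left, inner_sub_left, real_inner_smul_left,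
      real_inner_smul_left, real_inner_comm (y - x) n]
  have h3 : 2 * inner ℝ (x - p) (y - x) ≤ -‖y - x‖ ^ 2 := by
    have := pow_le_pow_left₀ (norm_nonneg _) hy 2
    rw [← sub_add_sub_cancel' x p y, norm_add_sq_real] at this
    linarith
  have hc : 0 < c := by linarith
  -- Orthogonality of `w` to `N` eliminates the normal component `α`.
  have h4 : c * inner ℝ w (y - x) = μ * (c * inner ℝ (x - p) (y - x) - h * e) := by
    rw [h2]
    linear_combination e * (-h1)
  -- The bounds on `h` and `e` give `‖y - x‖² / 4`; `c ≥ 1/2` is exactly what the ball inequality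
  -- `h3` needs to absorb this.
  have h5 : |h * e| ≤ c / 2 * ‖y - x‖ ^ 2 := by
    rw [abs_mul]
    calc |h| * |e| ≤ (ρ / 2) * |e| := by gcongr
      _ ≤ (1 / 2) / 2 * ‖y - x‖ ^ 2 := by linarith
      _ ≤ _ := by gcongr
  have h6 : c * inner ℝ (x - p) (y - x) - h * e ≤ 0 := by
    have := neg_abs_le (h * e)
    nlinarith
  by_contra! hcon
  nlinarith [mul_pos hc hcon, mul_nonneg hμ (neg_nonneg.2 h6)]

/-- Over each point of the projection plane on the segment between the projections of two points of
the surface patch lies a point of the patch. -/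
theorem exists_mem_over_segment {M : Set E3} (hsurf : IsC2Surface M) (hM : IsCompact M)
    {ρ : ℝ} (hu : HasUniqueNearest M ρ) {ν : E3 → E3}
    (hνc : ContinuousOn ν M) (hν : ∀ q ∈ M, IsUnitNormalAt M q (ν q)) {p : E3} (hp : p ∈ M)
    {R : ℝ} (hR : 0 < R) (hRρ : R < ρ) {x₁ x₂ z₁ z₂ : E3} (h₁ : x₁ ∈ M ∩ closedBall p R)
    (h₂ : x₂ ∈ M ∩ closedBall p R) {t₁ t₂ : ℝ} (hz₁ : z₁ = x₁ + t₁ • ν p)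
    (hz₂ : z₂ = x₂ + t₂ • ν p) {s₁ s₂ : ℝ} (hs₁ : 0 ≤ s₁) (hs₂ : 0 ≤ s₂) (hs : s₁ + s₂ = 1) :
    ∃ x ∈ M ∩ closedBall p R, ∃ t : ℝ, s₁ • z₁ + s₂ • z₂ = x + t • ν p := by
  set N := ν p with hNdef
  have hN : IsUnitNormalAt M p N := hν p hp
  have hρ : 0 < ρ := hR.trans hRρ
  set z := s₁ • z₁ + s₂ • z₂ with hz
  set W : E3 → E3 := fun x => (z - x) - inner ℝ (z - x) N • N with hW
  have hWN : ∀ x, inner ℝ (W x) N = 0 := by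
    intro x
    simp only [hW]
    rw [inner_sub_left, real_inner_smul_left, real_inner_self_eq_norm_sq, hN.1]
    ring
  have hWc : Continuous W := by fun_prop
  obtain ⟨x, hx, hmin⟩ := (hM.inter_right isClosed_closedBall).exists_isMinOn ⟨x₁, h₁⟩
    (hWc.norm.pow 2).continuousOn
  suffices hW0 : W x = 0 by
    refine ⟨x, hx, inner ℝ (z - x) N, ?_⟩
    rw [← sub_eq_zero.1 hW0]
    abel
  set w := W x with hw
  set n := ν x with hndef
  have hn : IsUnitNormalAt M x n := hν x hx.1
  have hxR : ‖x - p‖ ≤ R := by simpa [dist_eq_norm] using hx.2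
  -- Admissible variations: any tangent direction inside the ball, only those strictly entering it
  -- on the boundary sphere.
  have hcrit : ∀ v, inner ℝ v n = 0 → (‖x - p‖ < R ∨ inner ℝ v (x - p) < 0) →
      inner ℝ v w ≤ 0 := by
    intro v hv hdir
    obtain ⟨γ, h0, hγM, hγ⟩ := exists_curve_of_inner_eq_zero hsurf hx.1 hn hv
    have hball : ∀ᶠ t in 𝓝[>] (0 : ℝ), γ t ∈ closedBall p R := by
      rcases hdir with hlt | hlt
      · have := hγ.continuousAt.eventually_mem (isOpen_ball.mem_nhds (x := γ 0)
          (show γ 0 ∈ ball p R by rwa [h0, mem_ball, dist_eq_norm]))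
        exact (this.mono fun t ht => ball_subset_closedBall ht).filter_mono nhdsWithin_le_nhds
      · have hd : HasDerivAt (fun t => ‖γ t - p‖ ^ 2) (2 * inner ℝ (γ 0 - p) v) 0 :=
          (hγ.sub_const p).norm_sq
        rw [h0, real_inner_comm] at hd
        filter_upwards [eventually_lt_of_deriv_neg hd (by linarith)] with t ht
        rw [h0] at ht
        rw [mem_closedBall, dist_eq_norm]
        exact (lt_of_pow_lt_pow_left₀ 2 (norm_nonneg _) ht).le.trans hxR
    have hd : HasDerivAt (fun t => ‖W (γ t)‖ ^ 2)
        (2 * inner ℝ (W (γ 0)) (-v - inner ℝ (-v) N • N)) 0 := by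
      have h1 : HasDerivAt (fun t => z - γ t) (-v) 0 := hγ.const_sub z
      have h2 : HasDerivAt (fun t => inner ℝ (z - γ t) N) (inner ℝ (-v) N) 0 := by
        simpa using h1.inner ℝ (hasDerivAt_const (0 : ℝ) N)
      exact (h1.sub (h2.smul_const N)).norm_sq
    have := one_sided_deriv_nonneg hd (by
      filter_upwards [hball, hγM.filter_mono nhdsWithin_le_nhds] with t ht htM
      rw [h0]
      exact hmin ⟨htM, ht⟩)
    rw [h0, ← hw, inner_sub_right, inner_smul_right, hWN, inner_neg_right,
      real_inner_comm] at this
    linarith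
  have htan : ∀ u : E3, inner ℝ (u - inner ℝ u n • n) n = 0 := by
    intro u
    rw [inner_sub_left, real_inner_smul_left, real_inner_self_eq_norm_sq, hn.1]
    ring
  have hmem : ∀ u : E3, u - inner ℝ u n • n ∈ (ℝ ∙ n)ᗮ := fun u =>
    Submodule.mem_orthogonal_singleton_iff_inner_left.2 (htan u)
  have hproj : ∀ v u : E3, inner ℝ v n = 0 →
      inner ℝ v (u - inner ℝ u n • n) = inner ℝ v u := by
    intro v u hv
    rw [inner_sub_right, inner_smul_right, hv, mul_zero, sub_zero]
  have hreach : ∀ {q n' m : E3}, q ∈ M → IsUnitNormalAt M q n' → m ∈ M →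
      2 * ρ * |inner ℝ (m - q) n'| ≤ ‖m - q‖ ^ 2 := by
    intro q n' m hq hn' hm
    have h1 := two_mul_reach_mul_inner_le hsurf hM hρ hu hq hn' hm
    have h2 := two_mul_reach_mul_inner_le hsurf hM hρ hu hq hn'.neg hm
    rw [inner_neg_right] at h2
    rcases abs_cases (inner ℝ (m - q) n') with ⟨h, -⟩ | ⟨h, -⟩ <;> rw [h] <;> linarith
  have hcos : 1 / 2 ≤ inner ℝ N n :=
    half_le_inner_normal hsurf hM hu hνc hν hp hx.1 (hxR.trans_lt hRρ)
  obtain ⟨μ, hμ, hμe, hfar⟩ : ∃ μ : ℝ, 0 ≤ μ ∧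
      w - inner ℝ w n • n = μ • ((x - p) - inner ℝ (x - p) n • n) ∧
      (μ = 0 ∨ ‖x - p‖ = R) := by
    rcases hxR.lt_or_eq with hlt | heq
    · refine ⟨0, le_rfl, ?_, Or.inl rfl⟩
      have := hcrit _ (htan w) (Or.inl hlt)
      rw [← hproj _ w (htan w)] at this
      rw [zero_smul]
      exact inner_self_eq_zero.1 (le_antisymm this real_inner_self_nonneg)
    -- If `x - p` were normal at `x`, the tangent ball inequality would give `2ρR ≤ R²`, contrary to
    -- `0 < R < ρ`.
    · obtain ⟨μ, hμ, hμe⟩ := exists_nonneg_smul_of_inner_nonpos (ℝ ∙ n)ᗮ (hmem (x - p)) (hmem w) (by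
        intro h0
        have h1 : ‖x - p‖ = |inner ℝ (x - p) n| := by
          conv_lhs => rw [sub_eq_zero.1 h0]
          rw [norm_smul, hn.1, mul_one, Real.norm_eq_abs]
        have h2 := hreach hx.1 hn hp
        rw [← neg_sub, inner_neg_left, abs_neg, ← h1, norm_neg, heq] at h2
        nlinarith) (by
        intro v hv hneg
        have hv := Submodule.mem_orthogonal_singleton_iff_inner_left.1 hv
        rw [hproj _ _ hv] at hneg ⊢
        exact hcrit v hv (Or.inr hneg))
      exact ⟨μ, hμ, hμe, Or.inr heq⟩
  have hsupp : ∀ y ∈ M ∩ closedBall p R, inner ℝ w (y - x) ≤ 0 := by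
    intro y hy
    have hyR : ‖y - p‖ ≤ R := by simpa [dist_eq_norm] using hy.2
    have hh : |inner ℝ (x - p) N| ≤ ρ / 2 := by
      have := hreach hp hN hx.1
      nlinarith [norm_nonneg (x - p)]
    rcases hfar with h0 | heq
    -- Here `w` is a multiple of `n` orthogonal to `N`; since `⟪N, n⟫ ≥ 1/2`, it vanishes.
    · have hwn : w = inner ℝ w n • n := by
        rw [h0, zero_smul] at hμe
        exact sub_eq_zero.1 hμe
      have h1 := hWN x
      rw [← hw, hwn, real_inner_smul_left, real_inner_comm N n] at h1
      have h2 : inner ℝ w n = 0 := by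
        rcases mul_eq_zero.1 h1 with h | h
        · exact h
        · linarith
      rw [hwn, h2, zero_smul, inner_zero_left]
    · exact inner_sub_nonpos_of_tangential_eq hcos hh (hWN x) hμ hμe
        (hyR.trans_eq heq.symm) (hreach hx.1 hn hy.1)
  have hz1 : inner ℝ w (z₁ - x) ≤ 0 := by
    rw [hz₁, add_sub_right_comm, inner_add_right, inner_smul_right, hWN, mul_zero, add_zero]
    exact hsupp x₁ h₁
  have hz2 : inner ℝ w (z₂ - x) ≤ 0 := by
    rw [hz₂, add_sub_right_comm, inner_add_right, inner_smul_right, hWN, mul_zero, add_zero]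
    exact hsupp x₂ h₂
  have hzx : z - x = s₁ • (z₁ - x) + s₂ • (z₂ - x) := by
    have hxs : x = (s₁ + s₂) • x := by rw [hs, one_smul]
    conv_lhs => rw [hz, hxs, add_smul]
    rw [smul_sub, smul_sub]
    abel
  have hle : inner ℝ w (z - x) ≤ 0 := by
    rw [hzx, inner_add_right, inner_smul_right, inner_smul_right]
    nlinarith
  have hww : inner ℝ w w = inner ℝ w (z - x) := by
    conv_lhs => rw [hw, hW, inner_sub_right, inner_smul_right]
    change inner ℝ w (z - x) - inner ℝ (z - x) N * inner ℝ w N = _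
    rw [hWN, mul_zero, sub_zero]
  exact inner_self_eq_zero.1 (le_antisymm (hww ▸ hle) real_inner_self_nonneg)

/-! ### Choice of normal and of open or closed ball -/

theorem projectionAlong_neg (N : E3) (A : AffineSubspace ℝ E3) (S : Set E3) :
    projectionAlong (-N) A S = projectionAlong N A S := by
  have : ∀ N : E3, projectionAlong (-N) A S ⊆ projectionAlong N A S := by
    rintro N y ⟨hy, x, hx, t, rfl⟩
    exact ⟨hy, x, hx, -t, by rw [smul_neg, neg_smul]⟩
  exact (this N).antisymm (by simpa using this (-N))

/-- A unit normal vector is unique up to sign. -/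
theorem IsUnitNormalAt.eq_or_eq_neg {M : Set E3} (hsurf : IsC2Surface M) {p N N' : E3} (hp : p ∈ M)
    (hN : IsUnitNormalAt M p N) (hN' : IsUnitNormalAt M p N') : N' = N ∨ N' = -N := by
  set v := N' - inner ℝ N' N • N with hv
  have hvN : inner ℝ v N = 0 := by
    rw [hv, inner_sub_left, real_inner_smul_left, real_inner_self_eq_norm_sq, hN.1]
    ring
  have hvN' : inner ℝ v N' = 0 :=
    hN'.2 v (Submodule.subset_span (exists_curve_of_inner_eq_zero hsurf hp hN hvN))
  have hvv : inner ℝ v v = 0 := by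
    conv_lhs => rw [hv, inner_sub_right, ← hv, inner_smul_right, hvN, hvN', mul_zero, sub_zero]
  have h := sub_eq_zero.1 (inner_self_eq_zero.1 hvv)
  have habs : |inner ℝ N' N| = 1 := by
    have := congrArg norm h
    rwa [norm_smul, hN.1, hN'.1, mul_one, Real.norm_eq_abs, eq_comm] at this
  rcases eq_or_eq_neg_of_abs_eq habs with h1 | h1
  · exact Or.inl (by rw [h, h1, one_smul])
  · exact Or.inr (by rw [h, h1, neg_smul, one_smul])

/-- Open and closed balls are treated together: two points of `S` lie in the closed ball through the
one farther from `p`, whose radius is below `ρ` and whose part of `M` stays in `S`. Radius zero is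
separate. -/
theorem convex_projectionAlong_of_forall_closedBall {M : Set E3} {p N : E3}
    {A : AffineSubspace ℝ E3} {S : Set E3} {ρ : ℝ} (hSM : S ⊆ M)
    (hS : ∀ x ∈ S, dist x p < ρ ∧ M ∩ closedBall p (dist x p) ⊆ S)
    (h : ∀ R, 0 < R → R < ρ → ∀ x₁ ∈ M ∩ closedBall p R, ∀ x₂ ∈ M ∩ closedBall p R,
      ∀ t₁ t₂ s₁ s₂ : ℝ, 0 ≤ s₁ → 0 ≤ s₂ → s₁ + s₂ = 1 → ∃ x ∈ M ∩ closedBall p R, ∃ t : ℝ,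
        s₁ • (x₁ + t₁ • N) + s₂ • (x₂ + t₂ • N) = x + t • N) :
    Convex ℝ (projectionAlong N A S) := by
  rintro _ ⟨hA₁, x₁, hx₁, t₁, rfl⟩ _ ⟨hA₂, x₂, hx₂, t₂, rfl⟩ s₁ s₂ hs₁ hs₂ hs
  refine ⟨A.convex hA₁ hA₂ hs₁ hs₂ hs, ?_⟩
  obtain ⟨x₀, hx₀, h₁, h₂⟩ : ∃ x₀ ∈ S, dist x₁ p ≤ dist x₀ p ∧ dist x₂ p ≤ dist x₀ p := by
    rcases le_total (dist x₁ p) (dist x₂ p) with h | h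
    · exact ⟨x₂, hx₂, h, le_rfl⟩
    · exact ⟨x₁, hx₁, le_rfl, h⟩
  rcases (dist_nonneg (x := x₀) (y := p)).eq_or_lt with h0 | h0
  · rw [← h0] at h₁ h₂
    have e₁ := dist_le_zero.1 h₁
    have e₂ := dist_le_zero.1 h₂
    refine ⟨p, e₁ ▸ hx₁, s₁ * t₁ + s₂ * t₂, ?_⟩
    rw [e₁, e₂]
    calc _ = (s₁ + s₂) • p + (s₁ * t₁ + s₂ * t₂) • N := by module
      _ = _ := by rw [hs, one_smul]
  · obtain ⟨x, hx, t, ht⟩ := h _ h0 (hS x₀ hx₀).1 x₁ ⟨hSM hx₁, h₁⟩ x₂ ⟨hSM hx₂, h₂⟩ t₁ t₂ s₁ s₂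
      hs₁ hs₂ hs
    exact ⟨x, (hS x₀ hx₀).2 hx, t, ht⟩

theorem lemma1 (M : Set E3) (hsurf : IsC2Surface M) (hcompact : IsCompact M)
    (horient : IsOrientableSurface M) (ρ : ℝ) (hρ : 0 < ρ) (hreach : IsReach M ρ)
    (p : E3) (hp : p ∈ M) (N : E3) (hN : IsUnitNormalAt M p N) (r : ℝ) (hr : r < ρ) :
    Convex ℝ (projectionAlong N (tangentPlane M p) (Metric.closedBall p r ∩ M)) ∧
      Convex ℝ (projectionAlong N (tangentPlane M p) (Metric.ball p r ∩ M)) := by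
  obtain ⟨ν, hνc, hν⟩ := horient
  have hNν : ∀ S, projectionAlong N (tangentPlane M p) S =
      projectionAlong (ν p) (tangentPlane M p) S := by
    intro S
    rcases (hν p hp).eq_or_eq_neg hsurf hp hN with h | h
    · rw [h]
    · rw [h, projectionAlong_neg]
  rw [hNν, hNν]
  have key := fun R (hR : 0 < R) (hRρ : R < ρ) x₁ (h₁ : x₁ ∈ M ∩ closedBall p R) x₂
      (h₂ : x₂ ∈ M ∩ closedBall p R) t₁ t₂ s₁ s₂ (hs₁ : 0 ≤ s₁) (hs₂ : 0 ≤ s₂) hs =>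
    exists_mem_over_segment hsurf hcompact hreach.hasUniqueNearest hνc hν hp hR hRρ h₁ h₂
      (t₁ := t₁) (t₂ := t₂) rfl rfl hs₁ hs₂ hs
  constructor
  · refine convex_projectionAlong_of_forall_closedBall Set.inter_subset_right ?_ key
    exact fun x hx => ⟨(mem_closedBall.1 hx.1).trans_lt hr,
      fun y hy => ⟨(mem_closedBall.1 hy.2).trans (mem_closedBall.1 hx.1), hy.1⟩⟩
  · refine convex_projectionAlong_of_forall_closedBall Set.inter_subset_right ?_ key
    exact fun x hx => ⟨(mem_ball.1 hx.1).trans hr,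
      fun y hy => ⟨(mem_closedBall.1 hy.2).trans_lt (mem_ball.1 hx.1), hy.1⟩⟩
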